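/- Let $N\ge 0$ be an integer and let $d\ge 2$ be an even integer. Let $V(\mathbb{R})=\mathbb{R}[X_0,\dots,X_N]_d$ be the finite-dimensional real vector space of real homogeneous polynomials of degree $d$ in $N+1$ variables, with its usual (Euclidean) topology. Let $B(\mathbb{R})\subset V(\mathbb{R})$ be the set of those $F$ whose complex zero locus $\{F=0\}\subset\mathbb{P}^N_{\mathbb{C}}$ is a smooth hypersurface, that is, $F\neq 0$ and at every $x\in\mathbb{C}^{N+1}\setminus\{0\}$ with $F(x)=0$ some partial derivative $\partial F/\partial X_i$ does not vanish (for $N=0$ the empty zero locus of a nonzero form counts as a smooth hypersurface). Let $P_d^{\mathrm{sm}}\subset B(\mathbb{R})$ be the set of those $F\in B(\mathbb{R})$ that are positive semidefinite, i.e. $F(x)\ge 0$ for all $x\in\mathbb{R}^{N+1}$, and let $P_d^+\subset V(\mathbb{R})$ be the set of those $F$ such that $F(x)>0$ for all $x\in\mathbb{R}^{N+1}\setminus\{0\}$. Then $P_d^{\mathrm{sm}}$ is an open subset of $V(\mathbb{R})$, it is connected (in particular nonempty), and $$P_d^{\mathrm{sm}}=B(\mathbb{R})\cap P_d^+ .$$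 -/

import Mathlib

/-- The real vector space of forms (homogeneous polynomials) of degree `d` in the `N + 1` variables
`X_0, …, X_N` with real coefficients. -/
abbrev RealForm (N d : ℕ) : Type :=
  ↥(MvPolynomial.homogeneousSubmodule (Fin (N + 1)) ℝ d)

/-- The usual topology of the finite-dimensional real vector space of forms of degree `d`: the
topology of coefficientwise convergence. -/
instance RealForm.topologicalSpace (N d : ℕ) : TopologicalSpace (RealForm N d) :=
  TopologicalSpace.induced (fun F m => MvPolynomial.coeff m F.1)
    (inferInstance : TopologicalSpace ((Fin (N + 1) →₀ ℕ) → ℝ))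

/-- `{F = 0}` is a smooth hypersurface of the complex projective space of dimension `N`: the form
`F` is nonzero, and at every point `[x]` of its zero locus the differential of `F` is nonzero. -/
def IsSmoothHypersurface {N : ℕ} (F : MvPolynomial (Fin (N + 1)) ℂ) : Prop :=
  F ≠ 0 ∧ ∀ x : Fin (N + 1) → ℂ, x ≠ 0 → MvPolynomial.eval x F = 0 →
    ∃ i, MvPolynomial.eval x (MvPolynomial.pderiv i F) ≠ 0

/-- The set `B(ℝ)` of real forms of degree `d` whose complex zero locus is a smooth hypersurface. -/
def smoothRealForms (N d : ℕ) : Set (RealForm N d) :=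
  {F | IsSmoothHypersurface (MvPolynomial.map (algebraMap ℝ ℂ) F.1)}

/-- The set `P_d^+` of forms that are strictly positive away from the origin. -/
def positiveForms (N d : ℕ) : Set (RealForm N d) :=
  {F | ∀ x : Fin (N + 1) → ℝ, x ≠ 0 → 0 < MvPolynomial.eval x F.1}

/-- The set `P_d^sm` of forms in `B(ℝ)` that are positive semidefinite. -/
def smoothPsdForms (N d : ℕ) : Set (RealForm N d) :=
  {F | F ∈ smoothRealForms N d ∧ ∀ x : Fin (N + 1) → ℝ, 0 ≤ MvPolynomial.eval x F.1}

open MvPolynomial Module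

/-! A psd form has zero gradient at each real zero, so a smooth one has no real zero except the
origin; this gives the equality. Openness follows by compactness of the unit spheres.

For connectedness, `positiveForms` is convex, and it remains to avoid singular forms. Singular
points of a positive form are nonreal, so singularity should cost real codimension two. For `d ≥ 3`,
vanishing of the gradient at a fixed nonreal point imposes `2(N+1)` independent real conditions
(`range_gradAtNode`), while the point moves in `2N` real parameters. A cone with apex `F` over the
singular positive forms adds one parameter and still has Hausdorff dimension below that of the whole
space (`dimH_singularConeSet_lt`). A positive `H` outside the cones over `F` and `G` therefore sees
both along segments of smooth forms. For `d = 2` positive forms are automatically smooth. -/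

/-- The exponents of the monomials of degree `d` in `N + 1` variables. -/
abbrev FormExponent (N d : ℕ) : Type :=
  {m : Fin (N + 1) →₀ ℕ // m.degree = d}

instance FormExponent.finite (N d : ℕ) : Finite (FormExponent N d) :=
  (Finsupp.finite_of_degree_eq d).to_subtype

noncomputable instance FormExponent.fintype (N d : ℕ) : Fintype (FormExponent N d) :=
  Fintype.ofFinite _

/-! ### Coefficient coordinates and continuity of evaluation. -/

namespace RealForm

variable {N d : ℕ}

lemma isHomogeneous (F : RealForm N d) : F.1.IsHomogeneous d :=
  (mem_homogeneousSubmodule d F.1).1 F.2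

lemma continuous_coeff (m : Fin (N + 1) →₀ ℕ) :
    Continuous fun F : RealForm N d => coeff m F.1 :=
  (continuous_apply m).comp continuous_induced_dom

lemma continuous_of_continuous_coeff {X : Type*} [TopologicalSpace X] {f : X → RealForm N d}
    (h : ∀ m : Fin (N + 1) →₀ ℕ, Continuous fun x => coeff m (f x).1) : Continuous f :=
  continuous_induced_rng.2 (continuous_pi h)

lemma sum_monomial_coeff (F : RealForm N d) :
    ∑ m : FormExponent N d, monomial m.1 (coeff m.1 F.1) = F.1 := by
  classical
  ext m
  rw [coeff_sum]
  simp only [coeff_monomial]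
  by_cases hm : m.degree = d
  · rw [Finset.sum_eq_single ⟨m, hm⟩]
    · simp
    · intro b _ hb
      rw [if_neg]
      intro h
      exact hb (Subtype.ext h)
    · simp
  · rw [F.isHomogeneous.coeff_eq_zero hm]
    refine Finset.sum_eq_zero fun b _ => if_neg ?_
    rintro rfl
    exact hm b.2

/-- A form is determined by its coefficients, which are arbitrary. -/
noncomputable def coeffEquiv (N d : ℕ) : RealForm N d ≃ₗ[ℝ] (FormExponent N d → ℝ) where
  toFun F m := coeff m.1 F.1
  map_add' F G := by ext m; simp
  map_smul' c F := by ext m; simp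
  invFun v := ⟨∑ m, monomial m.1 (v m), Submodule.sum_mem _ fun m _ =>
    (mem_homogeneousSubmodule _ _).2 (isHomogeneous_monomial _ m.2)⟩
  left_inv F := by
    apply Subtype.ext
    exact sum_monomial_coeff F
  right_inv v := by
    classical
    ext m
    simp only [coeff_sum, coeff_monomial]
    rw [Finset.sum_eq_single m]
    · simp
    · intro b _ hb
      exact if_neg fun h => hb (Subtype.ext h)
    · simp

lemma coeffEquiv_apply (F : RealForm N d) (m : FormExponent N d) :
    coeffEquiv N d F m = coeff m.1 F.1 := rfl

lemma continuous_coeffEquiv_symm : Continuous (coeffEquiv N d).symm := by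
  refine continuous_of_continuous_coeff fun m => ?_
  by_cases hm : m.degree = d
  · have : (fun v => coeff m ((coeffEquiv N d).symm v).1) = fun v => v ⟨m, hm⟩ := by
      ext v
      rw [← coeffEquiv_apply _ ⟨m, hm⟩, LinearEquiv.apply_symm_apply]
    rw [this]
    exact continuous_apply _
  · have : (fun v => coeff m ((coeffEquiv N d).symm v).1) = fun _ => 0 := by
      ext v
      exact (isHomogeneous _).coeff_eq_zero hm
    rw [this]
    exact continuous_const

instance finiteDimensional : FiniteDimensional ℝ (RealForm N d) :=
  (coeffEquiv N d).symm.finiteDimensional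

lemma finrank_eq_card : finrank ℝ (RealForm N d) = Fintype.card (FormExponent N d) := by
  rw [(coeffEquiv N d).finrank_eq, finrank_fintype_fun_eq_card]

/-- Values of a form, or of the image of a form under a linear operator on polynomials, depend
continuously on the form and on the point. -/
lemma continuous_aeval {A : Type*} [CommRing A] [Algebra ℝ A] [TopologicalSpace A]
    [IsTopologicalRing A] [ContinuousSMul ℝ A]
    (D : MvPolynomial (Fin (N + 1)) ℝ →ₗ[ℝ] MvPolynomial (Fin (N + 1)) ℝ) :
    Continuous fun p : RealForm N d × (Fin (N + 1) → A) => aeval p.2 (D p.1.1) := by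
  have h : (fun p : RealForm N d × (Fin (N + 1) → A) => aeval p.2 (D p.1.1)) =
      fun p => ∑ m : FormExponent N d, coeff m.1 p.1.1 • aeval p.2 (D (monomial m.1 1)) := by
    ext p
    conv_lhs => rw [← sum_monomial_coeff p.1]
    rw [map_sum, map_sum]
    refine Finset.sum_congr rfl fun m _ => ?_
    rw [← map_smul, ← map_smul, smul_monomial, smul_eq_mul, mul_one]
  rw [h]
  refine continuous_finsetSum _ fun m _ => ?_
  refine Continuous.smul ((continuous_coeff _).comp continuous_fst) ?_
  have hc : Continuous fun x : Fin (N + 1) → A => aeval x (D (monomial m.1 1)) := by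
    simp only [aeval_def, eval₂_eq]
    fun_prop
  exact hc.comp continuous_snd

end RealForm

lemma MvPolynomial.IsHomogeneous.aeval_smul {σ R A : Type*} [CommSemiring R] [CommSemiring A]
    [Algebra R A] {p : MvPolynomial σ R} {n : ℕ} (hp : p.IsHomogeneous n) (c : A) (x : σ → A) :
    MvPolynomial.aeval (c • x) p = c ^ n * MvPolynomial.aeval x p := by
  simp only [aeval_def, eval₂_eq, Finset.mul_sum]
  refine Finset.sum_congr rfl fun m hm => ?_
  have hdeg : m.degree = n := by
    by_contra h
    exact (mem_support_iff.1 hm) (hp.coeff_eq_zero h)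
  simp only [Pi.smul_apply, smul_eq_mul, mul_pow, Finset.prod_mul_distrib,
    Finset.prod_pow_eq_pow_sum]
  rw [← Finsupp.degree_apply, hdeg]
  ring

/-- Tube lemma, applied below with `K` a unit sphere, to which homogeneity reduces all nonzero
points. -/
lemma isOpen_setOf_forall_mem_of_isCompact {X Y : Type*} [TopologicalSpace X] [TopologicalSpace Y]
    {K : Set Y} (hK : IsCompact K) {U : Set (X × Y)} (hU : IsOpen U) :
    IsOpen {x | ∀ y ∈ K, (x, y) ∈ U} :=
  isOpen_iff_eventually.2 fun _ hx =>
    hK.eventually_forall_of_forall_eventually fun y hy => hU.mem_nhds (hx y hy)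

/-! ### Openness, smooth psd forms are positive, convexity. -/

section Smooth

variable {N d : ℕ}

lemma mem_smoothRealForms_iff {F : RealForm N d} :
    F ∈ smoothRealForms N d ↔ ∀ x : Fin (N + 1) → ℂ, x ≠ 0 → aeval x F.1 = 0 →
      ∃ i, aeval x (pderiv i F.1) ≠ 0 := by
  have h : F ∈ smoothRealForms N d ↔ MvPolynomial.map (algebraMap ℝ ℂ) F.1 ≠ 0 ∧
      ∀ x : Fin (N + 1) → ℂ, x ≠ 0 → aeval x F.1 = 0 → ∃ i, aeval x (pderiv i F.1) ≠ 0 := by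
    simp only [smoothRealForms, IsSmoothHypersurface, Set.mem_ofPred_eq, pderiv_map, eval_map,
      aeval_def]
  rw [h, and_iff_right_iff_imp]
  intro hF h0
  have h1 : F.1 = 0 := (map_injective _ (algebraMap ℝ ℂ).injective) (by rw [h0, map_zero])
  -- The zero form is singular at `(1, …, 1)`, so the condition `F ≠ 0` is redundant.
  obtain ⟨i, hi⟩ := hF 1 one_ne_zero (by rw [h1, map_zero])
  exact hi (by rw [h1, map_zero, map_zero])

lemma mem_smoothRealForms_iff_forall_sphere {F : RealForm N d} :
    F ∈ smoothRealForms N d ↔ ∀ x ∈ Metric.sphere (0 : Fin (N + 1) → ℂ) 1,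
      aeval x F.1 ≠ 0 ∨ ∃ i, aeval x (pderiv i F.1) ≠ 0 := by
  rw [mem_smoothRealForms_iff]
  constructor
  · intro h x hx
    by_cases h0 : aeval x F.1 = 0
    · exact Or.inr (h x (ne_zero_of_mem_unit_sphere ⟨x, hx⟩) h0)
    · exact Or.inl h0
  · intro h x hx h0
    have hn : (‖x‖ : ℂ)⁻¹ ≠ 0 := inv_ne_zero (by exact_mod_cast norm_ne_zero_iff.2 hx)
    have hs : (‖x‖ : ℂ)⁻¹ • x ∈ Metric.sphere (0 : Fin (N + 1) → ℂ) 1 := by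
      rw [mem_sphere_zero_iff_norm]
      exact norm_smul_inv_norm hx
    rcases h _ hs with h1 | ⟨i, hi⟩
    · rw [F.isHomogeneous.aeval_smul, h0, mul_zero] at h1
      exact absurd rfl h1
    · rw [F.isHomogeneous.pderiv.aeval_smul] at hi
      exact ⟨i, right_ne_zero_of_mul hi⟩

lemma isOpen_smoothRealForms : IsOpen (smoothRealForms N d) := by
  have h : smoothRealForms N d = {F | ∀ x ∈ Metric.sphere (0 : Fin (N + 1) → ℂ) 1,
      (F, x) ∈ {p : RealForm N d × (Fin (N + 1) → ℂ) | aeval p.2 p.1.1 ≠ 0} ∪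
        ⋃ i, {p : RealForm N d × (Fin (N + 1) → ℂ) | aeval p.2 (pderiv i p.1.1) ≠ 0}} := by
    ext F
    simp [mem_smoothRealForms_iff_forall_sphere]
  rw [h]
  refine isOpen_setOf_forall_mem_of_isCompact (isCompact_sphere _ _) (IsOpen.union ?_ ?_)
  · exact isOpen_ne.preimage (RealForm.continuous_aeval LinearMap.id)
  · exact isOpen_iUnion fun i =>
      isOpen_ne.preimage (RealForm.continuous_aeval (pderiv i).toLinearMap)

lemma isOpen_positiveForms : IsOpen (positiveForms N d) := by
  have h : positiveForms N d = {F | ∀ x ∈ Metric.sphere (0 : Fin (N + 1) → ℝ) 1,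
      (F, x) ∈ {p : RealForm N d × (Fin (N + 1) → ℝ) | 0 < aeval p.2 p.1.1}} := by
    ext F
    simp only [positiveForms, Set.mem_ofPred_eq, aeval_eq_eval]
    constructor
    · intro h x hx
      exact h x (ne_zero_of_mem_unit_sphere ⟨x, hx⟩)
    · intro h x hx
      have hn : 0 < ‖x‖ := norm_pos_iff.2 hx
      have hs : ‖x‖⁻¹ • x ∈ Metric.sphere (0 : Fin (N + 1) → ℝ) 1 := by
        rw [mem_sphere_zero_iff_norm]
        exact norm_smul_inv_norm hx
      have h1 := h _ hs
      have h2 := F.isHomogeneous.aeval_smul (A := ℝ) ‖x‖⁻¹ x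
      simp only [aeval_eq_eval] at h2
      replace h1 : 0 < eval (‖x‖⁻¹ • x) F.1 := h1
      replace h2 : eval (‖x‖⁻¹ • x) F.1 = ‖x‖⁻¹ ^ d * eval x F.1 := h2
      rw [h2] at h1
      exact pos_of_mul_pos_right h1 (by positivity)
  rw [h]
  exact isOpen_setOf_forall_mem_of_isCompact (isCompact_sphere _ _)
    (isOpen_lt continuous_const (RealForm.continuous_aeval LinearMap.id))

lemma MvPolynomial.hasDerivAt_eval_add_smul_single {σ : Type*} [DecidableEq σ]
    (p : MvPolynomial σ ℝ) (x : σ → ℝ) (i : σ) :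
    HasDerivAt (fun t : ℝ => eval (x + t • Pi.single i 1) p) (eval x (pderiv i p)) 0 := by
  induction p using MvPolynomial.induction_on with
  | C a => simpa using hasDerivAt_const (0 : ℝ) a
  | add p q hp hq =>
    simp only [map_add]
    exact hp.add hq
  | mul_X p j hp =>
    have hX : HasDerivAt (fun t : ℝ => x j + t * (Pi.single i 1 : σ → ℝ) j)
        ((Pi.single i 1 : σ → ℝ) j) 0 := by
      simpa using ((hasDerivAt_id (0 : ℝ)).mul_const ((Pi.single i 1 : σ → ℝ) j)).const_add (x j)
    have h := hp.mul hX
    have hs : eval x ((Pi.single i 1 : σ → MvPolynomial σ ℝ) j) = (Pi.single i 1 : σ → ℝ) j := by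
      by_cases hj : j = i
      · subst hj; simp
      · simp [hj]
    convert! h using 1
    · ext t
      simp
    · rw [pderiv_mul, pderiv_X]
      simp [hs]

/-- A polynomial that is nonnegative on real points has vanishing gradient at its real zeros. -/
lemma eval_pderiv_eq_zero_of_nonneg {σ : Type*} {p : MvPolynomial σ ℝ}
    (hp : ∀ x, 0 ≤ eval x p) {x : σ → ℝ} (hx : eval x p = 0) (i : σ) :
    eval x (pderiv i p) = 0 := by
  classical
  refine IsLocalMin.hasDerivAt_eq_zero ?_ (p.hasDerivAt_eval_add_smul_single x i)
  refine Filter.Eventually.of_forall fun t => ?_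
  simpa [hx] using hp (x + t • Pi.single i 1)

lemma MvPolynomial.aeval_ofReal {σ : Type*} (p : MvPolynomial σ ℝ) (x : σ → ℝ) :
    aeval (fun i => (x i : ℂ)) p = (eval x p : ℂ) :=
  aeval_algebraMap_apply ℂ x p

lemma smoothPsdForms_eq (hd : 0 < d) :
    smoothPsdForms N d = smoothRealForms N d ∩ positiveForms N d := by
  ext F
  constructor
  · rintro ⟨hF, hF0⟩
    refine ⟨hF, fun x hx => (hF0 x).lt_of_ne fun h => ?_⟩
    obtain ⟨i, hi⟩ := mem_smoothRealForms_iff.1 hF (fun i => (x i : ℂ))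
      (fun h0 => hx (funext fun i => by simpa using congrFun h0 i))
      (by rw [aeval_ofReal, ← h, Complex.ofReal_zero])
    rw [aeval_ofReal, eval_pderiv_eq_zero_of_nonneg hF0 h.symm] at hi
    exact hi Complex.ofReal_zero
  · rintro ⟨hF, hF0⟩
    refine ⟨hF, fun x => ?_⟩
    by_cases hx : x = 0
    · have h := F.isHomogeneous.aeval_smul (0 : ℝ) x
      rw [zero_pow hd.ne', zero_mul, zero_smul] at h
      rw [hx]
      exact h.ge
    · exact (hF0 x hx).le

/-- The Fermat form. -/
noncomputable def fermatForm (N d : ℕ) : RealForm N d :=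
  ⟨∑ i, X i ^ d, Submodule.sum_mem _ fun i _ =>
    (mem_homogeneousSubmodule _ _).2 (isHomogeneous_X_pow i d)⟩

lemma fermatForm_mem (hd0 : 0 < d) (hd : Even d) :
    fermatForm N d ∈ smoothRealForms N d ∩ positiveForms N d := by
  classical
  constructor
  · rw [mem_smoothRealForms_iff]
    intro x hx _
    obtain ⟨i, hi⟩ := Function.ne_iff.1 hx
    refine ⟨i, ?_⟩
    have h : pderiv i (fermatForm N d).1 = (d : MvPolynomial (Fin (N + 1)) ℝ) * X i ^ (d - 1) := by
      simp only [fermatForm, map_sum, pderiv_pow, pderiv_X]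
      rw [Finset.sum_eq_single i]
      · simp
      · intro j _ hj
        simp [hj]
      · simp
    rw [h]
    simp only [map_mul, map_natCast, map_pow, aeval_X]
    exact mul_ne_zero (Nat.cast_ne_zero.2 hd0.ne') (pow_ne_zero _ hi)
  · intro x hx
    obtain ⟨i, hi⟩ := Function.ne_iff.1 hx
    simp only [fermatForm, map_sum, map_pow, eval_X]
    exact Finset.sum_pos' (fun j _ => hd.pow_nonneg _) ⟨i, Finset.mem_univ _, hd.pow_pos hi⟩

lemma convex_positiveForms : Convex ℝ (positiveForms N d) := by
  intro F hF G hG a b ha hb hab x hx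
  have h1 := hF x hx
  have h2 := hG x hx
  have h : eval x (a • F + b • G).1 = a * eval x F.1 + b * eval x G.1 := by
    simp [smul_eval]
  rw [h]
  rcases ha.eq_or_lt with rfl | ha
  · rw [zero_add] at hab
    subst hab
    simpa using h2
  · positivity

end Smooth

/-! ### Forms singular at a nonreal point. -/

lemma MvPolynomial.pderiv_aeval {σ τ R : Type*} [Fintype σ] [CommSemiring R]
    (g : σ → MvPolynomial τ R) (p : MvPolynomial σ R) (i : τ) :
    pderiv i (aeval g p) = ∑ l, aeval g (pderiv l p) * pderiv i (g l) := by
  classical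
  induction p using MvPolynomial.induction_on with
  | C a => simp
  | add p q hp hq => simp only [map_add, hp, hq, add_mul, Finset.sum_add_distrib]
  | mul_X p j hp =>
    have h : ∀ l, aeval g ((Pi.single l 1 : σ → MvPolynomial σ R) j) =
        (if j = l then 1 else 0 : MvPolynomial τ R) := by
      intro l
      by_cases hl : j = l
      · subst hl; simp
      · simp [hl]
    simp only [map_mul, pderiv_mul, aeval_X, hp, map_add, pderiv_X, h, add_mul,
      Finset.sum_add_distrib, Finset.sum_mul]
    congr 1
    · exact Finset.sum_congr rfl fun l _ => by ring
    · simp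

lemma MvPolynomial.IsHomogeneous.aeval_eq_re_add_im {σ : Type*} {p : MvPolynomial σ ℝ}
    (hp : p.IsHomogeneous 1) (x : σ → ℂ) :
    MvPolynomial.aeval x p =
      (eval (fun i => (x i).re) p : ℂ) + (eval (fun i => (x i).im) p : ℂ) * Complex.I := by
  have h := (mem_homogeneousSubmodule 1 p).2 hp
  rw [homogeneousSubmodule_one_eq_span_X] at h
  clear hp
  induction h using Submodule.span_induction with
  | mem q hq =>
    obtain ⟨i, rfl⟩ := hq
    simp [Complex.re_add_im]
  | zero => simp
  | add p q _ _ hp hq =>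
    simp only [map_add, Complex.ofReal_add, hp, hq]
    ring
  | smul c p _ hp =>
    simp only [map_smul, hp, smul_eval, Complex.ofReal_mul, Complex.real_smul]
    ring

variable {N d : ℕ}

/-- The point `e_j + i e_k`. -/
noncomputable def nodePoint (j k : Fin (N + 1)) : Fin (N + 1) → ℂ :=
  fun l => if l = j then 1 else if l = k then Complex.I else 0

/-- The gradient at `e_j + i e_k` of a real form. -/
noncomputable def gradAtNode (d : ℕ) (j k : Fin (N + 1)) :
    RealForm N d →ₗ[ℝ] (Fin (N + 1) → ℂ) where
  toFun F l := aeval (nodePoint j k) (pderiv l F.1)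
  map_add' F G := by ext l; simp
  map_smul' c F := by ext l; simp

lemma gradAtNode_apply (j k : Fin (N + 1)) (F : RealForm N d) (l : Fin (N + 1)) :
    gradAtNode d j k F l = aeval (nodePoint j k) (pderiv l F.1) := rfl

/-- Since `X l` vanishes at the node, a multiple of it has only its `l`-th partial there, equal to
the value of the cofactor, chosen to be `z`. -/
lemma single_mem_range_gradAtNode_of_ne {n : ℕ} {j k l : Fin (N + 1)} (hjk : j ≠ k)
    (hlj : l ≠ j) (hlk : l ≠ k) (z : ℂ) :
    Pi.single l z ∈ LinearMap.range (gradAtNode (n + 2) j k) := by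
  let p : MvPolynomial (Fin (N + 1)) ℝ :=
    X l * (C z.re * X j ^ (n + 1) + C z.im * (X j ^ n * X k))
  have hp : p.IsHomogeneous (n + 2) := by
    have h1 : (X l : MvPolynomial (Fin (N + 1)) ℝ).IsHomogeneous 1 := isHomogeneous_X _ _
    have h2 : (C z.re * X j ^ (n + 1) : MvPolynomial (Fin (N + 1)) ℝ).IsHomogeneous (n + 1) :=
      isHomogeneous_C_mul_X_pow _ _ _
    have h3 : (C z.im * (X j ^ n * X k) : MvPolynomial (Fin (N + 1)) ℝ).IsHomogeneous (n + 1) :=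
      ((isHomogeneous_X_pow j n).mul (isHomogeneous_X _ k)).C_mul _
    have := h1.mul (h2.add h3)
    rwa [show 1 + (n + 1) = n + 2 by ring] at this
  refine ⟨⟨p, hp⟩, ?_⟩
  ext i
  rw [gradAtNode_apply]
  have hl : aeval (nodePoint j k) (X l : MvPolynomial (Fin (N + 1)) ℝ) = 0 := by
    simp [nodePoint, hlj, hlk]
  have hi : aeval (nodePoint j k) (pderiv i (X l : MvPolynomial (Fin (N + 1)) ℝ)) =
      if i = l then 1 else 0 := by
    by_cases h : i = l
    · subst h; simp
    · rw [pderiv_X_of_ne (Ne.symm h)]; simp [h]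
  simp only [p]
  rw [pderiv_mul, map_add, map_mul, map_mul, hl, hi, zero_mul, add_zero]
  by_cases h : i = l
  · subst h
    simp [nodePoint, hjk.symm, Complex.re_add_im]
  · simp [h]

/-- Four real coefficients match the real dimension of the two complex components at `j` and `k`;
this needs degree at least 3. -/
lemma exists_gradAtNode_eq_binary {n : ℕ} {j k : Fin (N + 1)} (hjk : j ≠ k) (α β γ δ : ℝ) :
    ∃ F : RealForm N (n + 3), gradAtNode (n + 3) j k F =
      Pi.single j (((n + 3) * α - (n + 1) * γ : ℝ) + ((n + 2) * β - n * δ : ℝ) * Complex.I) +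
      Pi.single k ((β - 3 * δ : ℝ) + (2 * γ : ℝ) * Complex.I) := by
  let p : MvPolynomial (Fin (N + 1)) ℝ :=
    C α * X j ^ (n + 3) + C β * (X j ^ (n + 2) * X k) + C γ * (X j ^ (n + 1) * X k ^ 2) +
      C δ * (X j ^ n * X k ^ 3)
  have hp : p.IsHomogeneous (n + 3) := by
    refine (((?_ : IsHomogeneous _ _).add ?_).add ?_).add ?_
    · exact isHomogeneous_C_mul_X_pow _ _ _
    · exact ((isHomogeneous_X_pow j (n + 2)).mul (isHomogeneous_X _ k)).C_mul _
    · exact ((isHomogeneous_X_pow j (n + 1)).mul (isHomogeneous_X_pow k 2)).C_mul _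
    · exact ((isHomogeneous_X_pow j n).mul (isHomogeneous_X_pow k 3)).C_mul _
  refine ⟨⟨p, hp⟩, ?_⟩
  have hI3 : Complex.I ^ 3 = -Complex.I := Complex.I_pow_three
  ext i
  rw [gradAtNode_apply]
  by_cases hij : i = j
  · subst hij
    simp [p, pderiv_X_of_ne hjk.symm, nodePoint, hjk, hjk.symm, hI3]
    ring
  by_cases hik : i = k
  · subst hik
    simp [p, pderiv_X_of_ne hjk, nodePoint, hjk.symm]
    ring
  · simp [p, pderiv_X_of_ne (Ne.symm hij), pderiv_X_of_ne (Ne.symm hik),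
      hij, hik]

lemma range_gradAtNode (hd : 3 ≤ d) {j k : Fin (N + 1)} (hjk : j ≠ k) :
    LinearMap.range (gradAtNode d j k) = ⊤ := by
  obtain ⟨n, rfl⟩ := Nat.exists_eq_add_of_le' hd
  have hn : (n : ℝ) + 3 ≠ 0 := by positivity
  rw [eq_top_iff]
  intro c _
  rw [← Finset.univ_sum_single c]
  refine Submodule.sum_mem _ fun l _ => ?_
  by_cases hlj : l = j
  · subst hlj
    -- The witnesses solve the 4×4 linear system; its block in `β`, `δ` has determinant `-2(n+3)`.
    obtain ⟨F, hF⟩ := exists_gradAtNode_eq_binary (n := n) hjk ((c l).re / (n + 3))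
      (3 * ((c l).im / (2 * (n + 3)))) 0 ((c l).im / (2 * (n + 3)))
    refine ⟨F, hF.trans ?_⟩
    have h1 : ((n : ℝ) + 3) * ((c l).re / (n + 3)) - (n + 1) * 0 = (c l).re := by
      field_simp
      ring
    have h2 : ((n : ℝ) + 2) * (3 * ((c l).im / (2 * (n + 3)))) - n * ((c l).im / (2 * (n + 3))) =
        (c l).im := by
      field_simp
      ring
    rw [h1, h2, Complex.re_add_im]
    simp
  by_cases hlk : l = k
  · subst hlk
    obtain ⟨F, hF⟩ := exists_gradAtNode_eq_binary (n := n) hjk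
      ((n + 1) * ((c l).im / 2) / (n + 3)) (-(c l).re * n / (2 * (n + 3))) ((c l).im / 2)
      (-(c l).re * (n + 2) / (2 * (n + 3)))
    refine ⟨F, hF.trans ?_⟩
    have h1 : ((n : ℝ) + 3) * ((n + 1) * ((c l).im / 2) / (n + 3)) - (n + 1) * ((c l).im / 2) =
        0 := by
      field_simp
      ring
    have h2 : ((n : ℝ) + 2) * (-(c l).re * n / (2 * (n + 3))) -
        n * (-(c l).re * (n + 2) / (2 * (n + 3))) = 0 := by
      field_simp
      ring
    have h3 : -(c l).re * n / (2 * (n + 3)) - 3 * (-(c l).re * (n + 2) / (2 * (n + 3))) =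
        (c l).re := by
      field_simp
      ring
    have h4 : 2 * ((c l).im / 2) = (c l).im := by ring
    rw [h1, h2, h3, h4, Complex.re_add_im]
    simp
  · exact single_mem_range_gradAtNode_of_ne (n := n + 1) hjk hlj hlk (c l)

lemma finrank_ker_gradAtNode (hd : 3 ≤ d) {j k : Fin (N + 1)} (hjk : j ≠ k) :
    finrank ℝ (LinearMap.ker (gradAtNode d j k)) + 2 * (N + 1) =
      Fintype.card (FormExponent N d) := by
  have h := (gradAtNode d j k).finrank_range_add_finrank_ker
  rw [range_gradAtNode hd hjk, finrank_top, finrank_pi_fintype, RealForm.finrank_eq_card] at h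
  simp only [Complex.finrank_real_complex, Finset.sum_const, Finset.card_univ, Fintype.card_fin,
    smul_eq_mul] at h
  omega

/-- The substitution fixing the coordinate vectors other than `e_j` and `e_k`, which are sent to `a`
and `b`. -/
noncomputable def planeSubst (j k : Fin (N + 1)) (a b : Fin (N + 1) → ℝ) (l : Fin (N + 1)) :
    MvPolynomial (Fin (N + 1)) ℝ :=
  (if l = j ∨ l = k then 0 else X l) + C (a l) * X j + C (b l) * X k

lemma isHomogeneous_planeSubst (j k : Fin (N + 1)) (a b : Fin (N + 1) → ℝ) (l : Fin (N + 1)) :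
    (planeSubst j k a b l).IsHomogeneous 1 := by
  refine (IsHomogeneous.add ?_ (isHomogeneous_C_mul_X _ _)).add (isHomogeneous_C_mul_X _ _)
  split_ifs
  · exact isHomogeneous_zero _ _ _
  · exact isHomogeneous_X _ _

/-- The form obtained by the substitution `planeSubst`. -/
noncomputable def substForm (j k : Fin (N + 1)) (a b : Fin (N + 1) → ℝ) (F : RealForm N d) :
    RealForm N d :=
  ⟨aeval (planeSubst j k a b) F.1, by
    have h := F.isHomogeneous.aeval (planeSubst j k a b) (isHomogeneous_planeSubst j k a b)
    rw [one_mul] at h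
    exact (mem_homogeneousSubmodule _ _).2 h⟩

lemma aeval_nodePoint_planeSubst {j k : Fin (N + 1)} (hjk : j ≠ k) (a b : Fin (N + 1) → ℝ)
    (l : Fin (N + 1)) :
    aeval (nodePoint j k) (planeSubst j k a b l) = a l + b l * Complex.I := by
  have h : aeval (nodePoint j k)
      (if l = j ∨ l = k then 0 else X l : MvPolynomial (Fin (N + 1)) ℝ) = 0 := by
    split_ifs with h
    · simp
    · push Not at h
      simp [nodePoint, h]
  rw [planeSubst, map_add, map_add, h]
  simp [nodePoint, hjk.symm]

/-- A form singular at `a + i b` is moved to a form singular at `e_j + i e_k`. -/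
lemma substForm_mem_ker_gradAtNode {j k : Fin (N + 1)} (hjk : j ≠ k) {a b : Fin (N + 1) → ℝ}
    {F : RealForm N d} (hF : ∀ l, aeval (fun i => (a i + b i * Complex.I : ℂ)) (pderiv l F.1) = 0) :
    substForm j k a b F ∈ LinearMap.ker (gradAtNode d j k) := by
  rw [LinearMap.mem_ker]
  ext i
  rw [gradAtNode_apply, substForm, pderiv_aeval, map_sum]
  refine Finset.sum_eq_zero fun l _ => ?_
  have h : aeval (nodePoint j k) (aeval (planeSubst j k a b) (pderiv l F.1)) = 0 := by
    rw [← hF l, ← AlgHom.comp_apply, comp_aeval]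
    simp only [aeval_nodePoint_planeSubst hjk]
  rw [map_mul, h, zero_mul]

/-- The linear map `e_j ↦ a`, `e_k ↦ b` is invertible as `b k ≠ 0`; solving for the preimages of
`e_j` and `e_k` shows that its inverse has the same shape. -/
lemma exists_substForm_substForm_eq {j k : Fin (N + 1)} (hjk : j ≠ k) {a b : Fin (N + 1) → ℝ}
    (haj : a j = 1) (hbj : b j = 0) (hbk : b k ≠ 0) :
    ∃ a' b' : Fin (N + 1) → ℝ, a' j = 1 ∧ b' j = 0 ∧
      ∀ F : RealForm N d, substForm j k a' b' (substForm j k a b F) = F := by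
  refine ⟨fun l => if l = j then 1 else if l = k then -a k / b k else -a l + b l * (a k / b k),
    fun l => if l = j then 0 else if l = k then 1 / b k else -b l / b k, by simp, by simp, ?_⟩
  intro F
  apply Subtype.ext
  simp only [substForm]
  rw [← AlgHom.comp_apply, comp_aeval]
  conv_rhs => rw [← aeval_X_left_apply F.1]
  congr 2
  ext1 l
  by_cases hlj : l = j
  · subst hlj
    simp [planeSubst, haj, hbj, hjk]
  have hC : (C (b k) : MvPolynomial (Fin (N + 1)) ℝ) * C (b k)⁻¹ = 1 := by
    rw [← C_mul, mul_inv_cancel₀ hbk, C_1]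
  by_cases hlk : l = k
  · subst hlk
    simp [planeSubst, hjk, hjk.symm, div_eq_mul_inv, algebraMap_eq]
    linear_combination (X l - C (a l) * X j) * hC
  · simp [planeSubst, hlj, hlk, hjk, hjk.symm, div_eq_mul_inv, algebraMap_eq]
    ring

/-- A strictly positive singular form has a nonreal singular point, so it comes by a substitution
from a form singular at `e_j + i e_k`. -/
lemma exists_eq_substForm {F : RealForm N d} (hF : F ∈ positiveForms N d)
    (hF' : F ∉ smoothRealForms N d) :
    ∃ j k : Fin (N + 1), j ≠ k ∧ ∃ G ∈ LinearMap.ker (gradAtNode d j k),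
      ∃ a b : Fin (N + 1) → ℝ, a j = 1 ∧ b j = 0 ∧ F = substForm j k a b G := by
  rw [mem_smoothRealForms_iff] at hF'
  push Not at hF'
  obtain ⟨x, hx, hx0, hgrad⟩ := hF'
  obtain ⟨j, hj⟩ := Function.ne_iff.1 hx
  replace hj : x j ≠ 0 := hj
  -- Complex rescaling fixes one coordinate, leaving `2N` real parameters for the point.
  obtain ⟨z, hz⟩ : ∃ z, z = (x j)⁻¹ • x := ⟨_, rfl⟩
  have hzj : z j = 1 := by simp [hz, hj]
  have hz0 : aeval z F.1 = 0 := by rw [hz, F.isHomogeneous.aeval_smul, hx0, mul_zero]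
  have hzgrad : ∀ i, aeval z (pderiv i F.1) = 0 := fun i => by
    rw [hz, F.isHomogeneous.pderiv.aeval_smul, hgrad, mul_zero]
  -- Otherwise `z` would be a nonzero real zero of `F`.
  obtain ⟨k, hk⟩ : ∃ k, (z k).im ≠ 0 := by
    by_contra! h
    have hre : z = fun i => (((z i).re : ℝ) : ℂ) := by
      ext i
      apply Complex.ext <;> simp [h]
    rw [hre, aeval_ofReal, Complex.ofReal_eq_zero] at hz0
    refine (hF (fun i => (z i).re) ?_).ne' hz0
    intro h0
    have := congrFun h0 j
    simp [hzj] at this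
  have hjk : j ≠ k := by
    rintro rfl
    simp [hzj] at hk
  obtain ⟨a', b', ha', hb', h⟩ := exists_substForm_substForm_eq (d := d) hjk
    (a := fun i => (z i).re) (b := fun i => (z i).im) (by simp [hzj]) (by simp [hzj]) hk
  refine ⟨j, k, hjk, _, substForm_mem_ker_gradAtNode hjk (F := F) ?_, a', b', ha', hb', (h F).symm⟩
  intro l
  simpa only [Complex.re_add_im] using hzgrad l

/-- The gradient is linear with real coefficients, so it kills the real and imaginary parts of a
singular point; by Euler's identity `F` vanishes at both, which are then zero. -/
lemma mem_smoothRealForms_of_quadratic {F : RealForm N 2} (hF : F ∈ positiveForms N 2) :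
    F ∈ smoothRealForms N 2 := by
  rw [mem_smoothRealForms_iff]
  intro x hx _
  by_contra! h
  have hzero : ∀ y : Fin (N + 1) → ℝ, (∀ i, eval y (pderiv i F.1) = 0) → y = 0 := by
    intro y hy
    by_contra hy0
    have he := congrArg (eval y) F.isHomogeneous.sum_X_mul_pderiv
    simp only [map_sum, map_mul, hy, mul_zero, Finset.sum_const_zero, map_nsmul] at he
    have := hF y hy0
    rw [nsmul_eq_mul] at he
    push_cast at he
    linarith
  have hparts : ∀ i, eval (fun l => (x l).re) (pderiv i F.1) = 0 ∧
      eval (fun l => (x l).im) (pderiv i F.1) = 0 := by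
    intro i
    have hi := h i
    rw [F.isHomogeneous.pderiv.aeval_eq_re_add_im] at hi
    exact ⟨by simpa using congrArg Complex.re hi, by simpa using congrArg Complex.im hi⟩
  have hre := hzero _ fun i => (hparts i).1
  have him := hzero _ fun i => (hparts i).2
  refine hx (funext fun i => Complex.ext ?_ ?_)
  · exact congrFun hre i
  · exact congrFun him i

/-! ### Cones over singular forms and their dimension. -/

section ContDiffCoeff

variable {E σ : Type*} [NormedAddCommGroup E] [NormedSpace ℝ E]

/-- The coefficients of the family of polynomials `f` are continuously differentiable. -/
def ContDiffCoeff (f : E → MvPolynomial σ ℝ) : Prop :=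
  ∀ m, ContDiff ℝ 1 fun e => coeff m (f e)

namespace ContDiffCoeff

lemma const (p : MvPolynomial σ ℝ) : ContDiffCoeff fun _ : E => p := fun _ => contDiff_const

lemma add {f g : E → MvPolynomial σ ℝ} (hf : ContDiffCoeff f) (hg : ContDiffCoeff g) :
    ContDiffCoeff fun e => f e + g e := fun m => by
  simpa only [coeff_add] using (hf m).add (hg m)

lemma mul {f g : E → MvPolynomial σ ℝ} (hf : ContDiffCoeff f) (hg : ContDiffCoeff g) :
    ContDiffCoeff fun e => f e * g e := fun m => by
  classical
  simp only [coeff_mul]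
  exact ContDiff.sum fun i _ => (hf _).mul (hg _)

lemma sum {ι : Type*} (s : Finset ι) {f : ι → E → MvPolynomial σ ℝ}
    (hf : ∀ i ∈ s, ContDiffCoeff (f i)) : ContDiffCoeff fun e => ∑ i ∈ s, f i e := fun m => by
  simp only [coeff_sum]
  exact ContDiff.sum fun i hi => hf i hi m

lemma C {c : E → ℝ} (hc : ContDiff ℝ 1 c) :
    ContDiffCoeff fun e => (MvPolynomial.C (c e) : MvPolynomial σ ℝ) := fun m => by
  classical
  simp only [coeff_C]
  split_ifs
  · exact hc
  · exact contDiff_const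

lemma smul {c : E → ℝ} (hc : ContDiff ℝ 1 c) {f : E → MvPolynomial σ ℝ} (hf : ContDiffCoeff f) :
    ContDiffCoeff fun e => c e • f e := by
  simpa only [smul_eq_C_mul] using (ContDiffCoeff.C hc).mul hf

lemma aeval {τ : Type*} {g : E → τ → MvPolynomial σ ℝ} (hg : ∀ l, ContDiffCoeff fun e => g e l)
    (p : MvPolynomial τ ℝ) : ContDiffCoeff fun e => MvPolynomial.aeval (g e) p := by
  induction p using MvPolynomial.induction_on with
  | C a => simpa only [algHom_C] using ContDiffCoeff.const _
  | add p q hp hq => simpa only [map_add] using hp.add hq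
  | mul_X p j hp => simpa only [map_mul, aeval_X] using hp.mul (hg j)

end ContDiffCoeff

end ContDiffCoeff

/-- The parameters of the cone over the forms singular at some point `a + i b` with `a j = 1`,
`b j = 0`, `b k ≠ 0`. -/
abbrev ConeParam (d : ℕ) (j k : Fin (N + 1)) : Type :=
  (Fin (finrank ℝ (LinearMap.ker (gradAtNode d j k))) → ℝ) ×
    ({l : Fin (N + 1) // l ≠ j} → ℝ) × ({l : Fin (N + 1) // l ≠ j} → ℝ) × ℝ

/-- The vector with coordinate `c` at `j` and the other coordinates given by `v`. -/
def insertCoord (j : Fin (N + 1)) (c : ℝ) (v : {l : Fin (N + 1) // l ≠ j} → ℝ)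
    (l : Fin (N + 1)) : ℝ :=
  if h : l = j then c else v ⟨l, h⟩

lemma insertCoord_restrict (j : Fin (N + 1)) {c : ℝ} {a : Fin (N + 1) → ℝ} (ha : a j = c) :
    insertCoord j c (fun l => a l.1) = a := by
  ext l
  rw [insertCoord]
  split_ifs with h
  · rw [h, ha]
  · rfl

lemma contDiff_insertCoord {E : Type*} [NormedAddCommGroup E] [NormedSpace ℝ E] (j : Fin (N + 1))
    (c : ℝ) {v : E → {l : Fin (N + 1) // l ≠ j} → ℝ} (hv : ContDiff ℝ 1 v) (l : Fin (N + 1)) :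
    ContDiff ℝ 1 fun e => insertCoord j c (v e) l := by
  simp only [insertCoord]
  split_ifs with h
  · exact contDiff_const
  · exact contDiff_pi.1 hv ⟨l, h⟩

/-- A basis of the space of forms singular at `e_j + i e_k`. -/
noncomputable def nodeBasis (d : ℕ) (j k : Fin (N + 1)) :
    Basis (Fin (finrank ℝ (LinearMap.ker (gradAtNode d j k)))) ℝ
      (LinearMap.ker (gradAtNode d j k)) :=
  haveI := Free.of_divisionRing ℝ (LinearMap.ker (gradAtNode d j k))
  finBasis ℝ _

/-- The cone with apex `F` over singular forms. -/
noncomputable def singularCone (F : RealForm N d) (j k : Fin (N + 1)) (p : ConeParam d j k) :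
    RealForm N d :=
  F + p.2.2.2 • (substForm j k (insertCoord j 1 p.2.1) (insertCoord j 0 p.2.2.1)
    ((nodeBasis d j k).equivFun.symm p.1).1 - F)

lemma contDiff_singularCone (F : RealForm N d) (j k : Fin (N + 1)) :
    ContDiff ℝ 1 fun p => RealForm.coeffEquiv N d (singularCone F j k p) := by
  have hsubst : ∀ l, ContDiffCoeff fun p : ConeParam d j k =>
      planeSubst j k (insertCoord j 1 p.2.1) (insertCoord j 0 p.2.2.1) l := by
    intro l
    refine ((ContDiffCoeff.const _).add ?_).add ?_
    · exact (ContDiffCoeff.C (contDiff_insertCoord j 1 (by fun_prop) l)).mul (.const _)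
    · exact (ContDiffCoeff.C (contDiff_insertCoord j 0 (by fun_prop) l)).mul (.const _)
  have h : ContDiffCoeff fun p : ConeParam d j k => (singularCone F j k p).1 := by
    -- Expanding in the basis leaves only substitutions into fixed polynomials.
    have heq : (fun p : ConeParam d j k => (singularCone F j k p).1) = fun p =>
        F.1 + p.2.2.2 • ((∑ i, p.1 i •
          aeval (planeSubst j k (insertCoord j 1 p.2.1) (insertCoord j 0 p.2.2.1))
            (nodeBasis d j k i).1.1) + (-1 : ℝ) • F.1) := by
      ext1 p
      simp only [singularCone, substForm, Basis.equivFun_symm_apply, Submodule.coe_add,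
        Submodule.coe_smul, Submodule.coe_sum, map_sum, map_smul, neg_smul, one_smul,
        sub_eq_add_neg, Submodule.coe_neg]
    rw [heq]
    refine (ContDiffCoeff.const _).add (.smul (by fun_prop) (.add ?_ (.const _)))
    exact .sum _ fun i _ => .smul (by fun_prop) (.aeval hsubst _)
  exact contDiff_pi.2 fun m => h m.1

/-- With `M` coefficients, the count is `(M - 2(N+1)) + N + N + 1 = M - 1`. -/
lemma finrank_coneParam_lt (hd : 3 ≤ d) {j k : Fin (N + 1)} (hjk : j ≠ k) :
    finrank ℝ (ConeParam d j k) < Fintype.card (FormExponent N d) := by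
  have h := finrank_ker_gradAtNode hd hjk
  have hc : Fintype.card {l : Fin (N + 1) // l ≠ j} = N := by
    simp [Fintype.card_subtype_compl]
  simp only [ConeParam, finrank_prod, finrank_fintype_fun_eq_card, Fintype.card_fin, hc,
    finrank_self]
  omega

/-- Coefficient vectors of all singular cones with apex `F`. -/
def singularConeSet (F : RealForm N d) : Set (FormExponent N d → ℝ) :=
  ⋃ q : {q : Fin (N + 1) × Fin (N + 1) // q.1 ≠ q.2},
    Set.range fun p => RealForm.coeffEquiv N d (singularCone F q.1.1 q.1.2 p)

/-- A `C¹` image has Hausdorff dimension at most that of its parameter space, and a countable union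
does not raise the bound. -/
lemma dimH_singularConeSet_lt (hd : 3 ≤ d) (F : RealForm N d) :
    dimH (singularConeSet F) < finrank ℝ (FormExponent N d → ℝ) := by
  have hpos : 0 < Fintype.card (FormExponent N d) :=
    Fintype.card_pos_iff.2 ⟨⟨Finsupp.single 0 d, Finsupp.degree_single 0 d⟩⟩
  rw [singularConeSet, dimH_iUnion, finrank_fintype_fun_eq_card]
  refine (iSup_le fun q => ?_).trans_lt (Nat.cast_lt.2 (Nat.sub_one_lt hpos.ne'))
  refine (contDiff_singularCone F q.1.1 q.1.2).dimH_range_le.trans ?_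
  exact Nat.cast_le.2 (Nat.le_sub_one_of_lt (finrank_coneParam_lt hd q.2))

lemma segment_subset_of_notMem_singularConeSet {F H : RealForm N d}
    (hF : F ∈ smoothRealForms N d ∩ positiveForms N d) (hH : H ∈ positiveForms N d)
    (hcone : RealForm.coeffEquiv N d H ∉ singularConeSet F) :
    segment ℝ F H ⊆ smoothRealForms N d ∩ positiveForms N d := by
  intro S hS
  have hSpos := convex_positiveForms.segment_subset hF.2 hH hS
  refine ⟨?_, hSpos⟩
  by_contra hsing
  rw [segment_eq_image'] at hS
  obtain ⟨s, -, hs⟩ := hS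
  replace hs : F + s • (H - F) = S := hs
  have hs0 : s ≠ 0 := by
    rintro rfl
    rw [zero_smul, add_zero] at hs
    exact hsing (hs ▸ hF.1)
  obtain ⟨j, k, hjk, G, hG, a, b, ha, hb, hSG⟩ := exists_eq_substForm hSpos hsing
  -- If `S = F + s(H - F)` is singular, then `H = F + s⁻¹(S - F)` lies on the cone.
  refine hcone (Set.mem_iUnion.2 ⟨⟨(j, k), hjk⟩,
    ((nodeBasis d j k).equivFun ⟨G, hG⟩, fun l => a l.1,
      fun l => b l.1, s⁻¹), ?_⟩)
  simp only [singularCone]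
  rw [LinearEquiv.symm_apply_apply, insertCoord_restrict j ha, insertCoord_restrict j hb, ← hSG,
    ← hs, add_sub_cancel_left, smul_smul, inv_mul_cancel₀ hs0, one_smul, add_sub_cancel]

/-! ### Connectedness. -/

lemma RealForm.isPreconnected_segment (F H : RealForm N d) : IsPreconnected (segment ℝ F H) := by
  rw [segment_eq_image']
  refine isPreconnected_Icc.image _ (Continuous.continuousOn ?_)
  refine RealForm.continuous_of_continuous_coeff fun m => ?_
  have : (fun s : ℝ => coeff m (F + s • (H - F)).1) =
      fun s => coeff m F.1 + s * coeff m (H - F).1 := by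
    ext s
    simp
  rw [this]
  fun_prop

/-- Two smooth positive forms are joined by two segments meeting at a suitable third form. -/
lemma exists_segments_subset (hd0 : 0 < d) (hd : Even d) {F G : RealForm N d}
    (hF : F ∈ smoothRealForms N d ∩ positiveForms N d)
    (hG : G ∈ smoothRealForms N d ∩ positiveForms N d) :
    ∃ H, segment ℝ F H ⊆ smoothRealForms N d ∩ positiveForms N d ∧
      segment ℝ G H ⊆ smoothRealForms N d ∩ positiveForms N d := by
  by_cases h2 : d = 2
  · subst h2
    have h := convex_positiveForms.segment_subset hF.2 hG.2
    refine ⟨G, fun S hS => ⟨mem_smoothRealForms_of_quadratic (h hS), h hS⟩, ?_⟩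
    rw [segment_same]
    exact Set.singleton_subset_iff.2 hG
  have hd3 : 3 ≤ d := by
    obtain ⟨n, rfl⟩ := hd
    omega
  have hdim : dimH (singularConeSet F ∪ singularConeSet G) <
      finrank ℝ (FormExponent N d → ℝ) := by
    rw [dimH_union]
    exact max_lt (dimH_singularConeSet_lt hd3 F) (dimH_singularConeSet_lt hd3 G)
  -- The complement of the cones is dense, so it meets the nonempty open set of positive forms.
  obtain ⟨v, hv, hvcone⟩ := (dense_compl_of_dimH_lt_finrank hdim).inter_open_nonempty
    ((RealForm.coeffEquiv N d).symm ⁻¹' positiveForms N d)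
    (isOpen_positiveForms.preimage RealForm.continuous_coeffEquiv_symm)
    ⟨RealForm.coeffEquiv N d F, by simpa using hF.2⟩
  rw [← (RealForm.coeffEquiv N d).apply_symm_apply v] at hvcone
  exact ⟨(RealForm.coeffEquiv N d).symm v,
    segment_subset_of_notMem_singularConeSet hF hv fun h => hvcone (Or.inl h),
    segment_subset_of_notMem_singularConeSet hG hv fun h => hvcone (Or.inr h)⟩

theorem proposition3p4 (N d : ℕ) (hd0 : 0 < d) (hd : Even d) :
    IsOpen (smoothPsdForms N d) ∧ IsConnected (smoothPsdForms N d) ∧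
      smoothPsdForms N d = smoothRealForms N d ∩ positiveForms N d := by
  refine ⟨?_, ?_, smoothPsdForms_eq hd0⟩ <;> rw [smoothPsdForms_eq hd0]
  · exact isOpen_smoothRealForms.inter isOpen_positiveForms
  · refine ⟨⟨_, fermatForm_mem hd0 hd⟩, isPreconnected_of_forall_pair fun F hF G hG => ?_⟩
    obtain ⟨H, hFH, hGH⟩ := exists_segments_subset hd0 hd hF hG
    exact ⟨segment ℝ F H ∪ segment ℝ G H, Set.union_subset hFH hGH,
      Or.inl (left_mem_segment ℝ F H), Or.inr (left_mem_segment ℝ G H),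
      (RealForm.isPreconnected_segment F H).union H (right_mem_segment ℝ F H)
        (right_mem_segment ℝ G H) (RealForm.isPreconnected_segment G H)⟩
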